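/- Let $\mathcal L$ be the propositional language built from countably infinitely many atomic sentences with negation $\neg$ and disjunction $\lor$. An argument is a pair $\Gamma \succ \Delta$ of finite (possibly empty) sets of sentences. A probabilistic model consists of a nonempty set $W$, an algebra $\mathcal A$ of subsets of $W$, a map $[\![\cdot]\!] : \mathcal L \to \mathcal A$ with $[\![\neg\varphi]\!] = W \setminus [\![\varphi]\!]$ and $[\![\varphi\lor\psi]\!] = [\![\varphi]\!] \cup [\![\psi]\!]$, and a finitely additive probability function $P : \mathcal A \to [0,1]$; write $P(\varphi)$ for $P([\![\varphi]\!])$. An upset is a set $\alpha \subseteq [0,1]$ with $1 \in \alpha$, $0 \notin \alpha$, such that $x \in \alpha$ and $x \le y \le 1$ imply $y \in \alpha$. An argument $\Gamma\succ\Delta$ is $\alpha$-symmetric valid if there is no probabilistic model such that $P(\gamma) \in \alpha$ for all $\gamma \in \Gamma$ and $1 - P(\delta) \in \alpha$ for all $\delta \in \Delta$. The $\alpha$-symmetric consequence relation is the set of all $\alpha$-symmetric valid arguments. 1. For every real $x \in (0,1)$, the $[x,1]$-symmetric and the $(x,1]$-symmetric consequence relations are distinct if and only if $x$ is rational. 2.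 For any distinct $x, y \in (0,1]$, the $[x,1]$-symmetric and the $[y,1]$-symmetric consequence relations are distinct; and so there are uncountably many distinct symmetric consequence relations, that is, the set of all $\alpha$-symmetric consequence relations, $\alpha$ ranging over all upsets, is uncountable. -/

import Mathlib

universe u

namespace ProbLogic

/-- The propositional language: countably many atomic sentences, negation, disjunction. -/
inductive Sentence : Type
  | atom : ℕ → Sentence
  | neg : Sentence → Sentence
  | or : Sentence → Sentence → Sentence

/-- An argument: a pair of finite sets of sentences (either of which may be empty). -/
structure Argument : Type where
  premises : Finset Sentence
  conclusions : Finset Sentence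

/-- A probabilistic model: a nonempty set of worlds, an algebra of sets of worlds, a classical
denotation function into the algebra, and a finitely additive probability function on it. -/
structure ProbModel : Type (u + 1) where
  World : Type u
  nonempty : Nonempty World
  algebra : Set (Set World)
  isSetAlgebra : MeasureTheory.IsSetAlgebra algebra
  den : Sentence → algebra
  den_neg : ∀ φ, (den (.neg φ) : Set World) = (den φ : Set World)ᶜ
  den_or : ∀ φ ψ, (den (.or φ ψ) : Set World) = (den φ : Set World) ∪ (den ψ : Set World)
  prob : algebra → Set.Icc (0 : ℝ) 1
  prob_empty : (prob ⟨∅, isSetAlgebra.empty_mem⟩ : ℝ) = 0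
  prob_compl : ∀ A : algebra,
    (prob ⟨(A : Set World)ᶜ, isSetAlgebra.compl_mem A.2⟩ : ℝ) = 1 - prob A
  prob_union : ∀ A B : algebra, (A : Set World) ∩ B = ∅ →
    (prob ⟨(A : Set World) ∪ B, isSetAlgebra.union_mem A.2 B.2⟩ : ℝ) = prob A + prob B

/-- The probability of a sentence in a model is the probability of its denotation. -/
def ProbModel.sentenceProb (M : ProbModel.{u}) (φ : Sentence) : ℝ := M.prob (M.den φ)

/-- Upsets of `[0, 1]`, which by convention contain `1` and do not contain `0`. -/
structure IsUpset (α : Set ℝ) : Prop where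
  subset_Icc : α ⊆ Set.Icc 0 1
  one_mem : (1 : ℝ) ∈ α
  zero_notMem : (0 : ℝ) ∉ α
  mem_of_le : ∀ x ∈ Set.Icc (0 : ℝ) 1, ∀ y ∈ Set.Icc (0 : ℝ) 1, x ≤ y → x ∈ α → y ∈ α

/-- The mirror image of a set of probabilities. -/
def mirror (α : Set ℝ) : Set ℝ := {x | x ∈ Set.Icc (0 : ℝ) 1 ∧ 1 - x ∈ α}

/-- `M` is an `α`-symmetric counterexample to the argument `a`: all premises have probability in
`α`, all conclusions have probability in the mirror image of `α`. -/
def IsSymCounterexample (α : Set ℝ) (M : ProbModel.{u}) (a : Argument) : Prop :=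
  M.sentenceProb '' (a.premises : Set Sentence) ⊆ α ∧
    M.sentenceProb '' (a.conclusions : Set Sentence) ⊆ mirror α

/-- The `α`-symmetric consequence relation, as the set of `α`-symmetric valid arguments: those
that have no `α`-symmetric counterexample. -/
def symConsequence (α : Set ℝ) : Set Argument :=
  {a | ∀ M : ProbModel.{u}, ¬ IsSymCounterexample α M a}

end ProbLogic

/-! On finitely many atoms, a model amounts to a probability distribution on finitely many
valuations (`ProbModel.exists_weights`, `weightedModel`).

Irrational `x`: take a `ℚ`-linear `g : ℝ → ℚ` with `g 1 = 0` and `g x = 1`, and replace each weight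
`p` by `p + ε * g p`. By linearity the probability of every relevant sentence changes by the same
rule, and the total stays `1`. For small `ε > 0` strict inequalities survive, while the value `x`
rises to `x + ε`; a counterexample for `[x,1]` thus becomes one for `(x,1]`
(`IsSymCounterexample.exists_Ioc`).

Rational `a / b`: let `φ i` say that atom `i` holds and at most `a` of the first `b` atoms hold. At
most `a` of the `φ i` are ever true together, so their probabilities sum to at most `a` and cannot
all exceed `a / b`; a uniform distribution on cyclic shifts gives each exactly `a / b`
(`exists_argument_threshold`). Hence a rational in one upset and below all of another separates
their relations. Rationals being dense, `x ↦ [x,1]` yields uncountably many relations. -/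

namespace ProbLogic

/-! ### Classical semantics and functional completeness. -/

/-- Truth of a sentence under a classical valuation of the atoms. -/
def Sentence.Holds (v : ℕ → Prop) : Sentence → Prop
  | .atom n => v n
  | .neg φ => ¬ φ.Holds v
  | .or φ ψ => φ.Holds v ∨ ψ.Holds v

/-- A strict upper bound for the indices of the atoms of a sentence. -/
def Sentence.bound : Sentence → ℕ
  | .atom n => n + 1
  | .neg φ => φ.bound
  | .or φ ψ => max φ.bound ψ.bound

theorem Sentence.holds_congr {v v' : ℕ → Prop} (φ : Sentence)
    (h : ∀ i < φ.bound, (v i ↔ v' i)) : φ.Holds v ↔ φ.Holds v' := by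
  induction φ with
  | atom n => exact h n (Nat.lt_succ_self n)
  | neg φ ih => exact not_congr (ih h)
  | or φ ψ ih₁ ih₂ =>
    exact or_congr (ih₁ fun i hi => h i (lt_of_lt_of_le hi (le_max_left _ _)))
      (ih₂ fun i hi => h i (lt_of_lt_of_le hi (le_max_right _ _)))

/-- Functional completeness: a condition on the first `n` atoms is expressed by a sentence. -/
theorem exists_sentence_holds_iff (n : ℕ) (U : (ℕ → Prop) → Prop)
    (hU : ∀ v v' : ℕ → Prop, (∀ i < n, (v i ↔ v' i)) → (U v ↔ U v')) :
    ∃ φ : Sentence, ∀ v, φ.Holds v ↔ U v := by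
  induction n generalizing U with
  | zero =>
    -- With no atoms to depend on, `U` is constant: a tautology or a contradiction expresses it.
    by_cases h : U fun _ => True
    · refine ⟨.or (.atom 0) (.neg (.atom 0)), fun v => ?_⟩
      have := hU v (fun _ => True) (by simp)
      simp only [Sentence.Holds]
      tauto
    · refine ⟨.neg (.or (.atom 0) (.neg (.atom 0))), fun v => ?_⟩
      have := hU v (fun _ => True) (by simp)
      simp only [Sentence.Holds]
      tauto
  | succ n ih =>
    have key : ∀ p : Prop, ∃ φ : Sentence, ∀ v, φ.Holds v ↔ U (Function.update v n p) := by
      intro p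
      refine ih (fun v => U (Function.update v n p)) fun v v' h => hU _ _ fun i hi => ?_
      rcases eq_or_ne i n with rfl | hne
      · simp
      · simpa [hne] using h i (by omega)
    obtain ⟨φ, hφ⟩ := key True
    obtain ⟨ψ, hψ⟩ := key False
    -- Case split on atom `n`: `(n ∧ φ) ∨ (¬n ∧ ψ)`, written with negation and disjunction only.
    refine ⟨.or (.neg (.or (.neg (.atom n)) (.neg φ))) (.neg (.or (.atom n) (.neg ψ))),
      fun v => ?_⟩
    simp only [Sentence.Holds, hφ, hψ]
    by_cases h : v n
    · have : Function.update v n True = v := by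
        rw [Function.update_eq_self_iff]; simp [h]
      simp [h, this]
    · have : Function.update v n False = v := by
        rw [Function.update_eq_self_iff]; simp [h]
      simp [h, this]

/-! ### Models as finite distributions on valuations. -/

/-- The valuation that a world of a model induces. -/
def ProbModel.valuation (M : ProbModel.{u}) (w : M.World) : ℕ → Prop :=
  fun n => w ∈ (M.den (.atom n) : Set M.World)

theorem ProbModel.mem_den_iff (M : ProbModel.{u}) (w : M.World) (φ : Sentence) :
    w ∈ (M.den φ : Set M.World) ↔ φ.Holds (M.valuation w) := by
  induction φ with
  | atom n => rfl
  | neg φ ih => rw [M.den_neg, Set.mem_compl_iff, ih]; rfl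
  | or φ ψ ih₁ ih₂ => rw [M.den_or, Set.mem_union, ih₁, ih₂]; rfl

theorem ProbModel.prob_eq_sum (M : ProbModel.{u}) {V : Type*} (A : V → M.algebra)
    (hA : ∀ i j, i ≠ j → (A i : Set M.World) ∩ A j = ∅) (T : Finset V) (B : M.algebra)
    (hB : (B : Set M.World) = ⋃ i ∈ T, (A i : Set M.World)) :
    (M.prob B : ℝ) = ∑ i ∈ T, (M.prob (A i) : ℝ) := by
  classical
  induction T using Finset.induction_on generalizing B with
  | empty =>
    have : B = ⟨∅, M.isSetAlgebra.empty_mem⟩ := Subtype.ext (by simpa using hB)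
    rw [this, M.prob_empty, Finset.sum_empty]
  | insert i T hi ih =>
    have hmem : (⋃ j ∈ T, (A j : Set M.World)) ∈ M.algebra :=
      M.isSetAlgebra.biUnion_mem T fun j _ => (A j).2
    have hBe : B = ⟨(A i : Set M.World) ∪ ⋃ j ∈ T, (A j : Set M.World),
        M.isSetAlgebra.union_mem (A i).2 hmem⟩ :=
      Subtype.ext (by rw [hB, Finset.set_biUnion_insert])
    have hdisj : (A i : Set M.World) ∩ (⋃ j ∈ T, (A j : Set M.World)) = ∅ := by
      simp only [Set.inter_iUnion, Set.iUnion_eq_empty]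
      exact fun j hj => hA i j fun h => hi (h ▸ hj)
    rw [hBe, M.prob_union (A i) ⟨_, hmem⟩ hdisj, ih ⟨_, hmem⟩ rfl, Finset.sum_insert hi]

/-- The extension by falsity of a valuation of the first `N` atoms. -/
def extendValuation {N : ℕ} (v : Fin N → Prop) : ℕ → Prop := fun i => ∃ h : i < N, v ⟨i, h⟩

open Classical in
/-- On sentences with boundedly many atoms, a model is a probability distribution on finitely many
valuations. -/
theorem ProbModel.exists_weights (M : ProbModel.{u}) (N : ℕ) :
    ∃ w : (Fin N → Prop) → ℝ, (∀ v, 0 ≤ w v) ∧ ∑ v, w v = 1 ∧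
      ∀ φ : Sentence, φ.bound ≤ N →
        M.sentenceProb φ = ∑ v, if φ.Holds (extendValuation v) then w v else 0 := by
  -- State descriptions: their denotations partition the worlds, and their probabilities are the
  -- weights.
  have hσ : ∀ v : Fin N → Prop, ∃ φ : Sentence, ∀ u, φ.Holds u ↔ ∀ i : Fin N, (u i ↔ v i) := by
    refine fun v => exists_sentence_holds_iff N (fun u => ∀ i : Fin N, (u i ↔ v i)) ?_
    exact fun u u' h => forall_congr' fun i => iff_congr (h i i.2) Iff.rfl
  choose σ hσ using hσ
  have hdisj : ∀ v v', v ≠ v' →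
      (M.den (σ v) : Set M.World) ∩ (M.den (σ v') : Set M.World) = ∅ := by
    intro v v' hne
    refine Set.eq_empty_of_forall_notMem fun w hw => hne (funext fun i => propext ?_)
    rw [Set.mem_inter_iff, M.mem_den_iff, M.mem_den_iff, hσ, hσ] at hw
    exact (hw.1 i).symm.trans (hw.2 i)
  refine ⟨fun v => M.prob (M.den (σ v)), fun v => (M.prob (M.den (σ v))).2.1, ?_, fun φ hφ => ?_⟩
  · have h := M.prob_eq_sum (fun v => M.den (σ v)) hdisj Finset.univ
      ⟨(∅ : Set M.World)ᶜ, M.isSetAlgebra.compl_mem M.isSetAlgebra.empty_mem⟩ (by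
        ext w
        simp only [Set.compl_empty, Set.mem_univ, Finset.mem_univ, Set.iUnion_true,
          Set.mem_iUnion, M.mem_den_iff, hσ, true_iff]
        exact ⟨fun i => M.valuation w i, fun i => Iff.rfl⟩)
    rw [← h, M.prob_compl ⟨∅, M.isSetAlgebra.empty_mem⟩, M.prob_empty, sub_zero]
  · rw [← Finset.sum_filter]
    refine M.prob_eq_sum (fun v => M.den (σ v)) hdisj _ (M.den φ) ?_
    ext w
    simp only [Set.mem_iUnion, Finset.mem_filter, Finset.mem_univ, true_and, M.mem_den_iff, hσ,
      exists_prop]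
    have key : ∀ v : Fin N → Prop, (∀ i : Fin N, (M.valuation w i ↔ v i)) →
        (φ.Holds (M.valuation w) ↔ φ.Holds (extendValuation v)) := fun v hv =>
      φ.holds_congr fun i hi => (hv ⟨i, hi.trans_le hφ⟩).trans
        ⟨fun h => ⟨hi.trans_le hφ, h⟩, fun h => h.2⟩
    constructor
    · exact fun h => ⟨fun i => M.valuation w i, (key _ fun i => Iff.rfl).1 h, fun i => Iff.rfl⟩
    · rintro ⟨v, h, hv⟩
      exact (key v hv).2 h

open Classical in
/-- The model with finitely many weighted worlds, all of whose sets of worlds are measurable. -/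
noncomputable def weightedModel {V : Type} [Fintype V] [Nonempty V] (w : V → ℝ)
    (hw : ∀ v, 0 ≤ w v) (hw1 : ∑ v, w v = 1) (val : V → ℕ → Prop) : ProbModel.{u} where
  World := ULift.{u} V
  nonempty := inferInstance
  algebra := Set.univ
  isSetAlgebra := ⟨Set.mem_univ _, fun _ _ => Set.mem_univ _, fun _ _ _ _ => Set.mem_univ _⟩
  den φ := ⟨{x | φ.Holds (val x.down)}, Set.mem_univ _⟩
  den_neg _ := rfl
  den_or _ _ := rfl
  prob A := ⟨∑ v, if ULift.up v ∈ A.1 then w v else 0,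
    Finset.sum_nonneg fun v _ => by split_ifs <;> simp [hw v],
    hw1 ▸ Finset.sum_le_sum fun v _ => by split_ifs <;> simp [hw v]⟩
  prob_empty := by simp
  prob_compl A := by
    simp only
    rw [← hw1, ← Finset.sum_sub_distrib]
    refine Finset.sum_congr rfl fun v _ => ?_
    by_cases h : ULift.up v ∈ A.1 <;> simp [h]
  prob_union A B hAB := by
    simp only
    rw [← Finset.sum_add_distrib]
    refine Finset.sum_congr rfl fun v _ => ?_
    have h : ¬ (ULift.up v ∈ A.1 ∧ ULift.up v ∈ B.1) := fun h => by
      have : ULift.up v ∈ A.1 ∩ B.1 := h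
      rw [hAB] at this
      exact this
    by_cases h₁ : ULift.up v ∈ A.1 <;> by_cases h₂ : ULift.up v ∈ B.1 <;> simp_all

open Classical in
theorem sentenceProb_weightedModel {V : Type} [Fintype V] [Nonempty V] (w : V → ℝ)
    (hw : ∀ v, 0 ≤ w v) (hw1 : ∑ v, w v = 1) (val : V → ℕ → Prop) (φ : Sentence) :
    (weightedModel.{u} w hw hw1 val).sentenceProb φ =
      ∑ v, if φ.Holds (val v) then w v else 0 := rfl

/-! ### Irrational thresholds: perturbing the weights. -/

theorem ProbModel.sentenceProb_mem_Icc (M : ProbModel.{u}) (φ : Sentence) :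
    M.sentenceProb φ ∈ Set.Icc (0 : ℝ) 1 := (M.prob (M.den φ)).2

/-- Irrationality puts `x` outside the rational line through `1`, so some functional kills that line
but not `x`; rescale it. -/
theorem exists_linearMap_of_irrational {x : ℝ} (hx : Irrational x) :
    ∃ g : ℝ →ₗ[ℚ] ℚ, g 1 = 0 ∧ g x = 1 := by
  have hx' : x ∉ Submodule.span ℚ {(1 : ℝ)} := by
    rw [Submodule.mem_span_singleton]
    rintro ⟨q, hq⟩
    exact hx ⟨q, by rw [← hq, Rat.smul_def, mul_one]⟩
  obtain ⟨f, hf, hf'⟩ := Submodule.exists_le_ker_of_notMem hx'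
  refine ⟨(f x)⁻¹ • f, ?_, ?_⟩
  · have : f 1 = 0 := hf' (Submodule.mem_span_singleton_self 1)
    simp [this]
  · simp [hf]

open Filter Topology in
theorem eventually_lt_perturbation {a b : ℝ} (c : ℝ) (h : a < b) :
    ∀ᶠ ε in 𝓝[>] (0 : ℝ), a < b + ε * c := by
  refine nhdsWithin_le_nhds (ContinuousAt.eventually_lt (f := fun _ => a)
    (g := fun ε => b + ε * c) continuousAt_const (by fun_prop) (by simpa using h))

open Filter Topology in
/-- A counterexample with an irrational threshold can be perturbed to a strict one. -/
theorem IsSymCounterexample.exists_Ioc {x : ℝ} (hx : Irrational x) {M : ProbModel.{u}}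
    {a : Argument} (h : IsSymCounterexample (Set.Icc x 1) M a) :
    ∃ M' : ProbModel.{u}, IsSymCounterexample (Set.Ioc x 1) M' a := by
  classical
  obtain ⟨g, hg1, hgx⟩ := exists_linearMap_of_irrational hx
  let N := max (a.premises.sup Sentence.bound) (a.conclusions.sup Sentence.bound)
  obtain ⟨w, hw, hw1, hM⟩ := M.exists_weights N
  -- Zero weights stay zero because `g 0 = 0`; positive ones stay positive for small `ε`.
  have hpos : ∀ p : ℝ, 0 ≤ p → ∀ᶠ ε in 𝓝[>] (0 : ℝ), 0 ≤ p + ε * g p := by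
    intro p hp
    rcases hp.eq_or_lt with rfl | hp
    · simp
    · exact (eventually_lt_perturbation _ hp).mono fun _ => le_of_lt
  have hgt : ∀ p : ℝ, x ≤ p → ∀ᶠ ε in 𝓝[>] (0 : ℝ), x < p + ε * g p := by
    intro p hp
    rcases hp.eq_or_lt with rfl | hp
    · rw [hgx]
      filter_upwards [self_mem_nhdsWithin] with ε hε
      simpa using hε
    · exact eventually_lt_perturbation _ hp
  have h₁ : ∀ᶠ ε in 𝓝[>] (0 : ℝ), ∀ v, 0 ≤ w v + ε * g (w v) :=
    eventually_all.2 fun v => hpos _ (hw v)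
  have h₂ : ∀ᶠ ε in 𝓝[>] (0 : ℝ), ∀ φ ∈ a.premises,
      x < M.sentenceProb φ + ε * g (M.sentenceProb φ) :=
    (Finset.eventually_all _).2 fun φ hφ => hgt _ (h.1 ⟨φ, hφ, rfl⟩).1
  have h₃ : ∀ᶠ ε in 𝓝[>] (0 : ℝ), ∀ φ ∈ a.conclusions,
      x < (1 - M.sentenceProb φ) + ε * g (1 - M.sentenceProb φ) :=
    (Finset.eventually_all _).2 fun φ hφ => hgt _ (h.2 ⟨φ, hφ, rfl⟩).2.1
  obtain ⟨ε, h₁, h₂, h₃⟩ := (h₁.and (h₂.and h₃)).exists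
  have hw1' : ∑ v, (w v + ε * g (w v)) = 1 := by
    rw [Finset.sum_add_distrib, ← Finset.mul_sum, ← Rat.cast_sum, ← map_sum, hw1, hg1]
    simp
  let M' : ProbModel.{u} := weightedModel (fun v => w v + ε * g (w v)) h₁ hw1' extendValuation
  have hM' : ∀ φ : Sentence, φ.bound ≤ N →
      M'.sentenceProb φ = M.sentenceProb φ + ε * g (M.sentenceProb φ) := by
    intro φ hφ
    rw [hM φ hφ, sentenceProb_weightedModel, map_sum, Rat.cast_sum, Finset.mul_sum,
      ← Finset.sum_add_distrib]
    refine Finset.sum_congr rfl fun v _ => ?_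
    split_ifs <;> simp
  refine ⟨M', ?_, ?_⟩
  · rintro _ ⟨φ, hφ, rfl⟩
    refine ⟨?_, (M'.sentenceProb_mem_Icc φ).2⟩
    rw [hM' φ ((Finset.le_sup (f := Sentence.bound) hφ).trans (le_max_left _ _))]
    exact h₂ φ hφ
  · rintro _ ⟨φ, hφ, rfl⟩
    have hmem := M'.sentenceProb_mem_Icc φ
    refine ⟨hmem, ?_, by linarith [hmem.1]⟩
    rw [hM' φ ((Finset.le_sup (f := Sentence.bound) hφ).trans (le_max_right _ _))]
    have := h₃ φ hφ
    -- Since `g 1 = 0`, the perturbation commutes with `p ↦ 1 - p`, so conclusions behave like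
    -- premises.
    rw [map_sub, hg1] at this
    push_cast at this
    linarith

theorem symConsequence_Icc_eq_Ioc {x : ℝ} (hx : Irrational x) :
    symConsequence.{u} (Set.Icc x 1) = symConsequence.{u} (Set.Ioc x 1) := by
  ext a
  constructor
  · exact fun h M hM => h M ⟨hM.1.trans Set.Ioc_subset_Icc_self,
      hM.2.trans fun y hy => ⟨hy.1, Set.Ioc_subset_Icc_self hy.2⟩⟩
  · intro h M hM
    obtain ⟨M', hM'⟩ := hM.exists_Ioc hx
    exact h M' hM'

/-! ### Rational thresholds: a counting argument. -/

theorem card_filter_sub_val_lt {b a : ℕ} [NeZero b] (hab : a ≤ b) (j : Fin b) :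
    (Finset.univ.filter fun i : Fin b => (j - i).val < a).card = a := by
  have h : (Finset.univ.filter fun i : Fin b => (j - i).val < a).card =
      (Finset.univ.filter fun i : Fin b => i.val < a).card :=
    Finset.card_equiv (Equiv.subLeft j) (by simp)
  rw [h, Fin.card_filter_val_lt, min_eq_right hab]

open Classical in
/-- Some argument has a model that makes all its premises as probable as a given rational number,
but none that makes all of them more probable. -/
theorem exists_argument_threshold {a b : ℕ} (hb : 0 < b) (hab : a ≤ b) :
    ∃ S : Finset Sentence,
      (∃ M : ProbModel.{u}, ∀ φ ∈ S, M.sentenceProb φ = (a : ℝ) / b) ∧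
      ∀ M : ProbModel.{u}, ∃ φ ∈ S, M.sentenceProb φ ≤ (a : ℝ) / b := by
  have : NeZero b := ⟨hb.ne'⟩
  have hb' : (0 : ℝ) < b := by exact_mod_cast hb
  let C : (ℕ → Prop) → Prop := fun v => (Finset.univ.filter fun j : Fin b => v j).card ≤ a
  have hφ : ∀ i : Fin b, ∃ φ : Sentence, ∀ v, φ.Holds v ↔ v i ∧ C v := by
    refine fun i => exists_sentence_holds_iff b (fun v => v i ∧ C v) fun v v' h => ?_
    have : (Finset.univ.filter fun j : Fin b => v j) = Finset.univ.filter fun j : Fin b => v' j :=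
      Finset.filter_congr fun j _ => h j j.2
    simp only [C, this, h i i.2]
  choose φ hφ using hφ
  refine ⟨Finset.univ.image φ, ?_, fun M => ?_⟩
  -- World `j` makes true the `a` cyclically consecutive atoms ending at `j`. Subtraction is modulo
  -- `b`, so each atom is true in exactly `a` of the `b` worlds.
  · refine ⟨weightedModel (V := Fin b) (fun _ => (b : ℝ)⁻¹) (fun _ => by positivity)
      (by simp [hb'.ne']) (fun j n => ∃ h : n < b, (j - ⟨n, h⟩).val < a), ?_⟩
    simp only [Finset.mem_image, Finset.mem_univ, true_and, forall_exists_index,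
      forall_apply_eq_imp_iff]
    intro i
    have hC : ∀ j : Fin b, C fun n => ∃ h : n < b, (j - ⟨n, h⟩).val < a := by
      intro j
      simp only [C, Fin.is_lt, exists_true_left, Fin.eta]
      exact (card_filter_sub_val_lt hab j).le
    rw [sentenceProb_weightedModel, ← Finset.sum_filter]
    simp only [hφ, hC, and_true, Fin.is_lt, exists_true_left, Fin.eta]
    have h : (Finset.univ.filter fun j : Fin b => (j - i).val < a).card =
        (Finset.univ.filter fun j : Fin b => j.val < a).card :=
      Finset.card_equiv (Equiv.subRight i) (by simp)
    rw [Finset.sum_const, h, Fin.card_filter_val_lt, min_eq_right hab, nsmul_eq_mul,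
      div_eq_mul_inv]
  · by_contra! hlt
    obtain ⟨w, hw, hw1, hM⟩ := M.exists_weights (Finset.univ.sup fun i => (φ i).bound)
    have h₁ : (a : ℝ) < ∑ i, M.sentenceProb (φ i) := by
      calc (a : ℝ) = ∑ _i : Fin b, (a : ℝ) / b := by simp; field_simp
        _ < _ := Finset.sum_lt_sum_of_nonempty Finset.univ_nonempty fun i _ =>
          hlt _ (Finset.mem_image_of_mem φ (Finset.mem_univ i))
    refine h₁.not_ge ?_
    calc ∑ i, M.sentenceProb (φ i)
        = ∑ i, ∑ v, if (φ i).Holds (extendValuation v) then w v else 0 :=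
          Finset.sum_congr rfl fun i _ =>
            hM _ (Finset.le_sup (f := fun i => (φ i).bound) (Finset.mem_univ i))
      _ = ∑ v, ∑ i, if (φ i).Holds (extendValuation v) then w v else 0 := Finset.sum_comm
      _ ≤ ∑ v, (a : ℝ) * w v := by
        refine Finset.sum_le_sum fun v _ => ?_
        rw [← Finset.sum_filter, Finset.sum_const, nsmul_eq_mul]
        refine mul_le_mul_of_nonneg_right (Nat.cast_le.2 ?_) (hw v)
        refine (le_or_gt _ a).elim id fun hlt => ?_
        -- One true `φ i` already forces the cap `C`, which bounds the number of true atoms and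
        -- hence of true `φ j`.
        obtain ⟨i, hi⟩ := Finset.card_pos.1 (a.zero_le.trans_lt hlt)
        refine (Finset.card_le_card fun j hj => ?_).trans
          ((hφ i _).1 (Finset.mem_filter.1 hi).2).2
        exact Finset.mem_filter.2 ⟨Finset.mem_univ j,
          ((hφ j _).1 (Finset.mem_filter.1 hj).2).1⟩
      _ = a := by rw [← Finset.mul_sum, hw1, mul_one]

/-- The threshold argument for `q`, with no conclusions, is valid for `β` and refuted for `α`. -/
theorem symConsequence_ne_of_rat {α β : Set ℝ} {q : ℚ} (h0 : (0 : ℝ) < q) (h1 : (q : ℝ) < 1)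
    (hα : (q : ℝ) ∈ α) (hβ : ∀ y ∈ β, (q : ℝ) < y) :
    symConsequence.{u} α ≠ symConsequence.{u} β := by
  have hq0 : 0 < q := by exact_mod_cast h0
  have hq1 : q < 1 := by exact_mod_cast h1
  have hnum : ((q.num.toNat : ℕ) : ℤ) = q.num := Int.toNat_of_nonneg (Rat.num_nonneg.2 hq0.le)
  have hle : q.num.toNat ≤ q.den := by
    have := Rat.num_lt_denom_iff.2 hq1
    omega
  have hq : ((q.num.toNat : ℕ) : ℝ) / q.den = q := by
    rw [Rat.cast_def q, ← Int.cast_natCast q.num.toNat, hnum]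
  obtain ⟨S, ⟨M, hM⟩, hS⟩ := exists_argument_threshold.{u} q.pos hle
  rw [hq] at hM hS
  intro heq
  have hmem : (⟨S, ∅⟩ : Argument) ∈ symConsequence.{u} β := by
    intro M' h
    obtain ⟨φ, hφ, hle⟩ := hS M'
    exact (hβ _ (h.1 ⟨φ, hφ, rfl⟩)).not_ge hle
  rw [← heq] at hmem
  refine hmem M ⟨?_, by simp⟩
  rintro _ ⟨φ, hφ, rfl⟩
  rw [hM φ hφ]
  exact hα

/-! ### Distinct closed thresholds. -/

theorem symConsequence_Icc_ne {x y : ℝ} (hx : 0 < x) (hxy : x < y) (hy : y ≤ 1) :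
    symConsequence.{u} (Set.Icc x 1) ≠ symConsequence.{u} (Set.Icc y 1) := by
  obtain ⟨q, hxq, hqy⟩ := exists_rat_btwn hxy
  exact symConsequence_ne_of_rat (hx.trans hxq) (hqy.trans_le hy)
    ⟨hxq.le, (hqy.trans_le hy).le⟩ fun z hz => hqy.trans_le hz.1

theorem isUpset_Icc {x : ℝ} (hx : x ∈ Set.Ioc (0 : ℝ) 1) : IsUpset (Set.Icc x 1) where
  subset_Icc := Set.Icc_subset_Icc_left hx.1.le
  one_mem := ⟨hx.2, le_rfl⟩
  zero_notMem h := h.1.not_gt hx.1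
  mem_of_le _ _ _ hz hyz hy := ⟨hy.1.trans hyz, hz.2⟩

end ProbLogic

theorem mainTheorem9 :
    (∀ x ∈ Set.Ioo (0 : ℝ) 1,
      ProbLogic.symConsequence.{u} (Set.Icc x 1) ≠ ProbLogic.symConsequence.{u} (Set.Ioc x 1) ↔
        ∃ q : ℚ, (q : ℝ) = x) ∧
    (∀ x ∈ Set.Ioc (0 : ℝ) 1, ∀ y ∈ Set.Ioc (0 : ℝ) 1, x ≠ y →
      ProbLogic.symConsequence.{u} (Set.Icc x 1) ≠ ProbLogic.symConsequence.{u} (Set.Icc y 1)) ∧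
    ¬ (ProbLogic.symConsequence.{u} '' {α : Set ℝ | ProbLogic.IsUpset α}).Countable := by
  have hne : ∀ x ∈ Set.Ioc (0 : ℝ) 1, ∀ y ∈ Set.Ioc (0 : ℝ) 1, x ≠ y →
      ProbLogic.symConsequence.{u} (Set.Icc x 1) ≠
        ProbLogic.symConsequence.{u} (Set.Icc y 1) := by
    intro x hx y hy hxy
    rcases hxy.lt_or_gt with h | h
    · exact ProbLogic.symConsequence_Icc_ne hx.1 h hy.2
    · exact (ProbLogic.symConsequence_Icc_ne hy.1 h hx.2).symm
  refine ⟨fun x hx => ⟨fun h => ?_, ?_⟩, hne, fun hc => ?_⟩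
  · by_contra hq
    exact h (ProbLogic.symConsequence_Icc_eq_Ioc hq)
  · rintro ⟨q, rfl⟩
    exact ProbLogic.symConsequence_ne_of_rat hx.1 hx.2 ⟨le_rfl, hx.2.le⟩ fun y hy => hy.1
  · have hsub : (fun x : ℝ => ProbLogic.symConsequence.{u} (Set.Icc x 1)) '' Set.Ioc 0 1 ⊆
        ProbLogic.symConsequence.{u} '' {α : Set ℝ | ProbLogic.IsUpset α} := by
      rintro _ ⟨x, hx, rfl⟩
      exact ⟨_, ProbLogic.isUpset_Icc hx, rfl⟩
    have hinj : Set.InjOn (fun x : ℝ => ProbLogic.symConsequence.{u} (Set.Icc x 1))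
        (Set.Ioc 0 1) := fun x hx y hy h => by_contra fun hxy => hne x hx y hy hxy h
    have hcount := Set.countable_of_injective_of_countable_image hinj (hc.mono hsub)
    exact (Cardinal.Real.Ioc_countable_iff.1 hcount).not_gt one_pos
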